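/- Let $n,N\in\mathbb N$ and, for $i,j\in\{1,\dots,N\}$, let $\phi_{ij}:[0,1]\to[0,\infty)$ be Lipschitz continuous with $\phi_{ij}=\phi_{ji}$. Put $a_{ij}(r)=\phi_{ij}(r)$ for $r\in[0,1)$ and $a_{ij}(r)=0$ for $r\ge 1$, and consider on $\mathbb R^{nN}$, with points $x=(x_1,\dots,x_N)$, $x_i\in\mathbb R^n$, the Hegselmann–Krause system $$\dot x_i=f_i(x):=\sum_{j=1}^N a_{ij}(\|x_i-x_j\|)\,(x_j-x_i),\qquad i=1,\dots,N.$$ For $f=(f_1,\dots,f_N)$ let $$F(x)=\bigcap_{\delta>0}\ \bigcap_{\lambda(Z)=0}\overline{\mathrm{co}}\,\{f(y): y\in B(x,\delta)\setminus Z\},$$ where $\lambda$ is the Lebesgue measure on $\mathbb R^{nN}$. A Filippov solution on $[0,T]$, $T>0$, is an absolutely continuous function $x:[0,T]\to\mathbb R^{nN}$ such that $\dot x(t)\in F(x(t))$ for almost every $t\in[0,T]$. Then the set of all initial data $\bar x\in\mathbb R^{nN}$ from which more than one Filippov solution starts, that is, for which there are $T>0$ and two Filippov solutions $x,y$ on $[0,T]$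 with $x(0)=y(0)=\bar x$ and $x(t)\ne y(t)$ for some $t\in[0,T]$, has Lebesgue measure zero. -/

import Mathlib

open MeasureTheory Set

noncomputable section

/-- The state space `ℝ^{nN}` of `N` agents in `ℝⁿ`, with its Euclidean norm; `x i` is the
state of agent `i`, an element of `EuclideanSpace ℝ (Fin n)`. -/
abbrev HKState (n N : ℕ) : Type :=
  PiLp 2 (fun _ : Fin N => EuclideanSpace ℝ (Fin n))

/-- The truncated interaction strength: `φ r` for `r ∈ [0, 1)` and `0` for `r ≥ 1`. -/
def hkCutoff (φ : ℝ → ℝ) : ℝ → ℝ := indicator (Ico 0 1) φ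

/-- The right-hand side of the Hegselmann-Krause system:
`f_i(x) = ∑_j a_ij(‖x_i - x_j‖) (x_j - x_i)`. -/
def hkField {n N : ℕ} (φ : Fin N → Fin N → ℝ → ℝ) (x : HKState n N) : HKState n N :=
  WithLp.toLp 2 (fun i => ∑ j, hkCutoff (φ i j) ‖x i - x j‖ • (x j - x i))

/-- The Filippov multifunction of a vector field `f`: the intersection, over all `δ > 0` and all
Lebesgue-null sets `Z`, of the closed convex hulls of `f (B(x, δ) \ Z)`. -/
def filippovMap {E : Type*} [NormedAddCommGroup E] [NormedSpace ℝ E] [MeasureSpace E]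
    (f : E → E) (x : E) : Set E :=
  ⋂ (δ : ℝ) (_ : 0 < δ) (Z : Set E) (_ : volume Z = 0),
    closure (convexHull ℝ (f '' (Metric.ball x δ \ Z)))

/-- `x` is a Filippov solution of `ẋ = f(x)` on `[0, T]`: it is absolutely continuous on `[0, T]`,
and for almost every `t ∈ [0, T]` it is differentiable at `t` with derivative in the
Filippov multifunction of `f` at `x t`. Only the values of `x` on `[0, T]` matter. -/
def IsFilippovSolution {E : Type*} [NormedAddCommGroup E] [NormedSpace ℝ E] [MeasureSpace E]
    (f : E → E) (T : ℝ) (x : ℝ → E) : Prop :=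
  AbsolutelyContinuousOnInterval x 0 T ∧
    ∀ᵐ t ∂(volume.restrict (Icc 0 T)), ∃ v ∈ filippovMap f (x t), HasDerivAt x v t

/-- The initial data from which more than one Filippov solution starts: on some interval `[0, T]`,
`T > 0`, there are two Filippov solutions from `x₀` that differ at some time of `[0, T]`. -/
def filippovNonuniqueData {E : Type*} [NormedAddCommGroup E] [NormedSpace ℝ E] [MeasureSpace E]
    (f : E → E) : Set E :=
  {x₀ | ∃ T : ℝ, 0 < T ∧ ∃ x y : ℝ → E,
    IsFilippovSolution f T x ∧ IsFilippovSolution f T y ∧ x 0 = x₀ ∧ y 0 = x₀ ∧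
      ∃ t ∈ Icc 0 T, x t ≠ y t}

end

/-! Forward uniqueness can fail, but backward uniqueness holds with a Lipschitz estimate. An
attraction that is switched off at distance 1 satisfies `⟪k u - k v, u - v⟫ ≤ C ‖u - v‖ ^ 2`, and
symmetry of the interactions turns this into `⟪f x - f y, x - y⟫ ≥ -C ‖x - y‖ ^ 2`, up to constants
(`inner_hkCutoffField_sub_ge`). Replacing the jump by steep ramps gives Lipschitz fields whose
backward time-`T` maps converge to a Lipschitz map `g`, and every Filippov solution satisfies `x 0 =
g (x T)`. If two solutions start at `p` and differ at time `T`, a Kneser-type connectedness argument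
shows that the fibre of `g` over `p` has a non-isolated point
(`exists_lipschitzWith_frequently_eq_of_filippov`). By Rademacher and Sard, almost every fibre of a
Lipschitz self-map has only isolated points (`LipschitzWith.ae_forall_eventually_ne`). Rational
times `T` suffice, so the exceptional set is null. -/

open scoped NNReal Topology

/-! ### Backward Grönwall estimate and flows of bounded Lipschitz fields. -/

section Curves

variable {E : Type*} [NormedAddCommGroup E] [InnerProductSpace ℝ E]

/-- Lipschitz functions preserve absolute continuity of curves. -/
theorem LipschitzWith.comp_absolutelyContinuousOnInterval {X Y : Type*} [PseudoMetricSpace X]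
    [PseudoMetricSpace Y] {K : ℝ≥0} {g : X → Y} (hg : LipschitzWith K g) {f : ℝ → X} {a b : ℝ}
    (hf : AbsolutelyContinuousOnInterval f a b) :
    AbsolutelyContinuousOnInterval (fun t => g (f t)) a b := by
  rw [absolutelyContinuousOnInterval_iff] at hf ⊢
  intro ε hε
  obtain ⟨δ, hδ, h⟩ := hf (ε / (K + 1)) (by positivity)
  refine ⟨δ, hδ, fun I hI hI' => ?_⟩
  have h1 := h I hI hI'
  rw [lt_div_iff₀ (by positivity)] at h1
  calc ∑ i ∈ Finset.range I.1, dist (g (f (I.2 i).1)) (g (f (I.2 i).2))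
      ≤ ∑ i ∈ Finset.range I.1, dist (f (I.2 i).1) (f (I.2 i).2) * (K + 1) := by
        refine Finset.sum_le_sum fun i _ => (hg.dist_le_mul _ _).trans ?_
        rw [mul_comm]
        exact mul_le_mul_of_nonneg_left (by linarith) dist_nonneg
    _ < ε := by rwa [← Finset.sum_mul]

/-- An absolutely continuous function whose derivative is almost everywhere at least `m` grows at
least at rate `m`. -/
theorem AbsolutelyContinuousOnInterval.mul_le_sub_of_ae_le_deriv {w : ℝ → ℝ} {T m : ℝ}
    (hT : 0 ≤ T) (hw : AbsolutelyContinuousOnInterval w 0 T)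
    (hm : ∀ᵐ t ∂(volume.restrict (Icc 0 T)), m ≤ deriv w t) : m * T ≤ w T - w 0 := by
  rw [← hw.integral_deriv_eq_sub]
  have h := intervalIntegral.integral_mono_ae_restrict (μ := volume) hT
    (intervalIntegrable_const (c := m)) hw.intervalIntegrable_deriv hm
  simpa [mul_comm] using h

/-- A one-sided Grönwall estimate backwards in time: if the velocities of two curves are
almost everywhere `C`-expansive up to an error `ε`, the initial distance is controlled by
the final one. -/
theorem norm_sub_sq_le_of_ae_inner_deriv_ge {x y : ℝ → E} {T C ε : ℝ} (hT : 0 ≤ T) (hC : 0 ≤ C)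
    (hε : 0 ≤ ε) (hx : AbsolutelyContinuousOnInterval x 0 T)
    (hy : AbsolutelyContinuousOnInterval y 0 T)
    (h : ∀ᵐ t ∂(volume.restrict (Icc 0 T)), ∃ v w, HasDerivAt x v t ∧ HasDerivAt y w t ∧
      -(C * ‖x t - y t‖ ^ 2) - ε ≤ inner ℝ (v - w) (x t - y t)) :
    ‖x 0 - y 0‖ ^ 2 ≤ Real.exp (2 * C * T) * (‖x T - y T‖ ^ 2 + 2 * T * ε) := by
  -- The weight absorbs the term `-2C‖x - y‖ ^ 2` in the derivative of `‖x - y‖ ^ 2`, leaving `w' ≥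
  -- -2ε exp (2CT)`.
  set w : ℝ → ℝ := fun t => Real.exp (2 * C * t) * (‖x t - y t‖ * ‖x t - y t‖) with hw
  have hn : AbsolutelyContinuousOnInterval (fun t => ‖x t - y t‖) 0 T :=
    lipschitzWith_one_norm.comp_absolutelyContinuousOnInterval (hx.sub hy)
  have he : AbsolutelyContinuousOnInterval (fun t => Real.exp (2 * C * t)) 0 T :=
    ContDiffOn.absolutelyContinuousOnInterval (by fun_prop)
  have hwac : AbsolutelyContinuousOnInterval w 0 T := he.fun_mul (hn.fun_mul hn)
  have key := hwac.mul_le_sub_of_ae_le_deriv (m := -(2 * ε * Real.exp (2 * C * T))) hT ?_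
  · simp only [hw, mul_zero, Real.exp_zero, one_mul] at key
    nlinarith
  · filter_upwards [h, ae_restrict_mem measurableSet_Icc] with t ⟨v, u, hv, hu, hvu⟩ ht
    have h1 : HasDerivAt (fun t => ‖x t - y t‖ ^ 2) (2 * inner ℝ (x t - y t) (v - u)) t :=
      (hv.sub hu).norm_sq
    have h2 : HasDerivAt (fun t => Real.exp (2 * C * t)) (Real.exp (2 * C * t) * (2 * C)) t := by
      have := ((hasDerivAt_id t).const_mul (2 * C)).exp
      simpa using this
    have h3 := (h2.mul h1).deriv
    have h4 : w = (fun t => Real.exp (2 * C * t)) * fun t => ‖x t - y t‖ ^ 2 := by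
      funext s; simp [hw, sq]
    rw [h4, h3, real_inner_comm]
    have h5 : Real.exp (2 * C * t) ≤ Real.exp (2 * C * T) :=
      Real.exp_le_exp.2 (mul_le_mul_of_nonneg_left ht.2 (by positivity))
    have h6 := Real.exp_pos (2 * C * t)
    nlinarith [mul_le_mul_of_nonneg_left hvu h6.le, mul_le_mul_of_nonneg_left h5 hε]

/-- Global solvability of an autonomous equation with bounded Lipschitz right-hand side. -/
theorem LipschitzWith.exists_hasDerivAt_of_bounded [CompleteSpace E] {h : E → E} {K M : ℝ≥0}
    (hK : LipschitzWith K h) (hM : ∀ x, ‖h x‖ ≤ M) {T t₀ : ℝ} (ht₀ : t₀ ∈ Icc 0 T) (p : E) :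
    ∃ y : ℝ → E, y t₀ = p ∧ ∀ t ∈ Icc 0 T, HasDerivAt y (h (y t)) t := by
  have hT : 0 ≤ T := ht₀.1.trans ht₀.2
  -- The margin of 1 on each side makes the derivatives at `0` and `T` two-sided.
  let s₀ : Icc (-1) (T + 1) := ⟨t₀, by linarith [ht₀.1], by linarith [ht₀.2]⟩
  have hpl : IsPicardLindelof (fun _ => h) s₀ p (M * (T + 1).toNNReal) 0 M K :=
    { lipschitzOnWith := fun _ _ => hK.lipschitzOnWith
      continuousOn := fun _ _ => continuousOn_const
      norm_le := fun _ _ x _ => hM x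
      mul_max_le := by
        have : max (T + 1 - t₀) (t₀ - -1) ≤ T + 1 := max_le (by linarith [ht₀.1])
          (by linarith [ht₀.2])
        rw [NNReal.coe_mul, NNReal.coe_zero, sub_zero, Real.coe_toNNReal _ (by linarith)]
        exact mul_le_mul_of_nonneg_left this M.2 }
  obtain ⟨y, hy, hy'⟩ := hpl.exists_eq_forall_mem_Icc_hasDerivWithinAt₀
  exact ⟨y, hy, fun t ht => (hy' t ⟨by linarith [ht.1], by linarith [ht.2]⟩).hasDerivAt
    (Icc_mem_nhds (by linarith [ht.1]) (by linarith [ht.2]))⟩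

/-- A curve with bounded derivative is absolutely continuous. -/
theorem absolutelyContinuousOnInterval_of_hasDerivAt_of_bounded {h : E → E} {M : ℝ≥0}
    (hM : ∀ x, ‖h x‖ ≤ M) {T : ℝ} (hT : 0 ≤ T) {y : ℝ → E}
    (hy : ∀ t ∈ Icc 0 T, HasDerivAt y (h (y t)) t) : AbsolutelyContinuousOnInterval y 0 T := by
  refine LipschitzOnWith.absolutelyContinuousOnInterval (K := M) ?_
  rw [uIcc_of_le hT]
  exact (convex_Icc 0 T).lipschitzOnWith_of_nnnorm_hasDerivWithin_le
    (fun t ht => (hy t ht).hasDerivWithinAt) fun t _ => hM _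

/-- The time-`T` flow of a bounded Lipschitz field and its inverse. -/
theorem LipschitzWith.exists_flow_of_bounded [CompleteSpace E] {h : E → E} {K M : ℝ≥0}
    (hK : LipschitzWith K h) (hM : ∀ x, ‖h x‖ ≤ M) {T : ℝ} (hT : 0 ≤ T) :
    ∃ Φ S : E → E, Continuous Φ ∧ (∀ z, Φ (S z) = z) ∧ (∀ p, S (Φ p) = p) ∧
      ∀ z, ∃ y : ℝ → E, y T = z ∧ y 0 = S z ∧ ∀ t ∈ Icc 0 T, HasDerivAt y (h (y t)) t := by
  choose a ha ha' using fun p => hK.exists_hasDerivAt_of_bounded hM (left_mem_Icc.2 hT) p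
  choose b hb hb' using fun z => hK.exists_hasDerivAt_of_bounded hM (right_mem_Icc.2 hT) z
  have hcont : ∀ {y : ℝ → E}, (∀ t ∈ Icc 0 T, HasDerivAt y (h (y t)) t) →
      ContinuousOn y (Icc 0 T) := fun hy t ht => (hy t ht).continuousAt.continuousWithinAt
  have hdist : ∀ {y z : ℝ → E}, (∀ t ∈ Icc 0 T, HasDerivAt y (h (y t)) t) →
      (∀ t ∈ Icc 0 T, HasDerivAt z (h (z t)) t) →
      dist (y T) (z T) ≤ dist (y 0) (z 0) * Real.exp (K * (T - 0)) := fun hy hz =>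
    dist_le_of_trajectories_ODE (v := fun _ => h) (fun _ => hK) (hcont hy)
      (fun t ht => (hy t (Ico_subset_Icc_self ht)).hasDerivWithinAt) (hcont hz)
      (fun t ht => (hz t (Ico_subset_Icc_self ht)).hasDerivWithinAt) le_rfl T (right_mem_Icc.2 hT)
  refine ⟨fun p => a p T, fun z => b z 0, ?_, fun z => ?_, fun p => ?_,
    fun z => ⟨b z, hb z, rfl, hb' z⟩⟩
  · refine (LipschitzWith.of_dist_le_mul (K := (Real.exp (K * (T - 0))).toNNReal)
      fun p q => ?_).continuous
    rw [Real.coe_toNNReal _ (Real.exp_pos _).le, mul_comm]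
    simpa only [ha] using hdist (ha' p) (ha' q)
  · have := hdist (ha' (b z 0)) (hb' z)
    rw [ha, dist_self, zero_mul, hb] at this
    exact dist_le_zero.1 this
  · have := ODE_solution_unique_of_mem_Icc_left (v := fun _ => h) (s := fun _ => univ)
      (fun _ _ => hK.lipschitzOnWith) (hcont (hb' (a p T)))
      (fun t ht => (hb' (a p T) t (Ioc_subset_Icc_self ht)).hasDerivWithinAt)
      (fun _ _ => mem_univ _) (hcont (ha' p))
      (fun t ht => (ha' p t (Ioc_subset_Icc_self ht)).hasDerivWithinAt)
      (fun _ _ => mem_univ _) (hb _) (left_mem_Icc.2 hT)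
    simpa only [ha] using this

end Curves

/-! ### Fibres of Lipschitz self-maps. -/

section Sard

variable {E : Type*} [NormedAddCommGroup E] [NormedSpace ℝ E] [FiniteDimensional ℝ E]
  [MeasurableSpace E] [BorelSpace E] (μ : Measure E) [μ.IsAddHaarMeasure]

/-- Lipschitz self-maps of a finite-dimensional space preserve null sets. -/
theorem LipschitzWith.addHaar_image_eq_zero {g : E → E} {K : ℝ≥0} (hg : LipschitzWith K g)
    {s : Set E} (hs : μ s = 0) : μ (g '' s) = 0 := by
  -- Hausdorff measure in the top dimension scales under Lipschitz maps, and it is a multiple of `μ`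
  -- and conversely.
  have h1 : (Measure.hausdorffMeasure (Module.finrank ℝ E : ℝ) : Measure E) s = 0 := by
    rw [Measure.isAddLeftInvariant_eq_smul (Measure.hausdorffMeasure (Module.finrank ℝ E : ℝ)) μ]
    simp [hs]
  have h2 := hg.hausdorffMeasure_image_le (d := Module.finrank ℝ E) (by positivity) s
  rw [h1, mul_zero, nonpos_iff_eq_zero] at h2
  rw [Measure.isAddLeftInvariant_eq_smul μ (Measure.hausdorffMeasure (Module.finrank ℝ E : ℝ))]
  simp [h2]

/-- Almost every fibre of a Lipschitz self-map of a finite-dimensional space is discrete. -/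
theorem LipschitzWith.ae_forall_eventually_ne {g : E → E} {K : ℝ≥0} (hg : LipschitzWith K g) :
    ∀ᵐ p ∂μ, ∀ z, g z = p → ∀ᶠ z' in 𝓝[≠] z, g z' ≠ p := by
  have h1 : μ (g '' {z | ¬ DifferentiableAt ℝ g z}) = 0 :=
    hg.addHaar_image_eq_zero μ (ae_iff.1 hg.ae_differentiableAt)
  have h2 : μ (g '' {z | DifferentiableAt ℝ g z ∧ (fderiv ℝ g z).det = 0}) = 0 :=
    addHaar_image_eq_zero_of_det_fderivWithin_eq_zero μ (f' := fderiv ℝ g)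
      (fun z hz => hz.1.hasFDerivAt.hasFDerivWithinAt) fun z hz => hz.2
  filter_upwards [measure_eq_zero_iff_ae_notMem.1 h1, measure_eq_zero_iff_ae_notMem.1 h2]
    with p hp1 hp2 z hz
  have hd : DifferentiableAt ℝ g z := by
    by_contra hd
    exact hp1 ⟨z, hd, hz⟩
  have hdet : (fderiv ℝ g z).det ≠ 0 := fun h => hp2 ⟨z, ⟨hd, h⟩, hz⟩
  -- An invertible derivative at `z` isolates `z` in its fibre.
  exact hd.hasFDerivAt.eventually_ne
    ⟨_, ((fderiv ℝ g z).toContinuousLinearEquivOfDetNeZero hdet).antilipschitz⟩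

end Sard

/-! ### Filippov solutions of fields with a lower one-sided Lipschitz bound. -/

section Filippov

open Filter Metric

variable {E : Type*} [NormedAddCommGroup E] [InnerProductSpace ℝ E] [MeasureSpace E]

/-- An expansivity estimate for `f` against `g` passes to the Filippov multifunction of `f`. -/
theorem inner_sub_ge_of_mem_filippovMap {f : E → E} {M C ε : ℝ} (hf : ∀ x, ‖f x‖ ≤ M)
    (hC : 0 ≤ C) {y b : E} (hb : ‖b‖ ≤ M)
    (h : ∀ x, -(C * ‖x - y‖ ^ 2) - ε ≤ inner ℝ (f x - b) (x - y))
    {x v : E} (hv : v ∈ filippovMap f x) :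
    -(C * ‖x - y‖ ^ 2) - ε ≤ inner ℝ (v - b) (x - y) := by
  -- The estimate at a point `u` near `x` is a half-space condition on `f u` once `u - y` is
  -- replaced by `x - y`, at a cost of `2Mδ`. Closed half-spaces survive closed convex hulls.
  have key : ∀ δ > 0, -(C * (‖x - y‖ + δ) ^ 2) - ε - 2 * M * δ + inner ℝ b (x - y) ≤
      inner ℝ v (x - y) := by
    intro δ hδ
    -- The null set `∅` suffices because `h` holds at every point.
    have hv' : v ∈ closure (convexHull ℝ (f '' (ball x δ \ ∅))) := by
      simp only [filippovMap, mem_iInter] at hv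
      exact hv δ hδ ∅ measure_empty
    rw [sdiff_empty] at hv'
    set c := -(C * (‖x - y‖ + δ) ^ 2) - ε - 2 * M * δ + inner ℝ b (x - y)
    have hclosed : IsClosed {w : E | c ≤ inner ℝ w (x - y)} :=
      isClosed_le continuous_const (by fun_prop)
    have hconv : Convex ℝ {w : E | c ≤ inner ℝ w (x - y)} := by
      intro u hu w hw a b ha hb hab
      simp only [mem_ofPred_eq, inner_add_left, real_inner_smul_left] at hu hw ⊢
      calc c = a * c + b * c := by rw [← add_mul, hab, one_mul]
        _ ≤ _ := add_le_add (mul_le_mul_of_nonneg_left hu ha) (mul_le_mul_of_nonneg_left hw hb)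
    refine closure_minimal (convexHull_min ?_ hconv) hclosed hv'
    rintro _ ⟨u, hu, rfl⟩
    have hux : ‖u - x‖ ≤ δ := (mem_ball_iff_norm.1 hu).le
    have h1 := h u
    have h2 : inner ℝ (f u - b) (u - y) = inner ℝ (f u - b) (u - x) + inner ℝ (f u) (x - y)
        - inner ℝ b (x - y) := by
      rw [← sub_add_sub_cancel u x y, inner_add_right, inner_sub_left (f u) b (x - y)]
      ring
    have h3 : inner ℝ (f u - b) (u - x) ≤ 2 * M * δ := by
      refine (real_inner_le_norm _ _).trans (mul_le_mul ?_ hux (norm_nonneg _) ?_)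
      · linarith [norm_sub_le (f u) b, hf u]
      · linarith [norm_nonneg b]
    have h4 : ‖u - y‖ ≤ ‖x - y‖ + δ := by
      linarith [norm_sub_le_norm_sub_add_norm_sub u x y]
    have h5 : C * ‖u - y‖ ^ 2 ≤ C * (‖x - y‖ + δ) ^ 2 := by gcongr
    simp only [mem_ofPred_eq, c]
    linarith
  have hlim : Tendsto (fun δ : ℝ => -(C * (‖x - y‖ + δ) ^ 2) - ε - 2 * M * δ + inner ℝ b (x - y))
      (𝓝[>] 0) (𝓝 (-(C * (‖x - y‖ + 0) ^ 2) - ε - 2 * M * 0 + inner ℝ b (x - y))) :=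
    (Continuous.tendsto (by fun_prop) 0).mono_left nhdsWithin_le_nhds
  have := le_of_tendsto hlim (eventually_mem_nhdsWithin.mono fun δ hδ => key δ hδ)
  rw [inner_sub_left]
  simp only [add_zero, mul_zero, sub_zero] at this
  linarith

theorem IsFilippovSolution.mono {f : E → E} {T t : ℝ} {x : ℝ → E} (hx : IsFilippovSolution f T x)
    (ht : 0 ≤ t) (htT : t ≤ T) : IsFilippovSolution f t x := by
  refine ⟨hx.1.mono ?_, ae_restrict_of_ae_restrict_of_subset (Icc_subset_Icc_right htT) hx.2⟩
  rw [uIcc_of_le ht, uIcc_of_le (ht.trans htT)]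
  exact Icc_subset_Icc_right htT

/-- The initial data from which two Filippov solutions start that differ at time `T`. -/
def filippovNonuniqueDataAt (f : E → E) (T : ℝ) : Set E :=
  {x₀ | ∃ x y : ℝ → E, IsFilippovSolution f T x ∧ IsFilippovSolution f T y ∧ x 0 = x₀ ∧ y 0 = x₀ ∧
    x T ≠ y T}

/-- By continuity, solutions that differ at `t` also differ just before `t`, hence at a rational
time that is still at most `T`. -/
theorem filippovNonuniqueData_subset (f : E → E) :
    filippovNonuniqueData f ⊆ ⋃ q : {q : ℚ // 0 < q}, filippovNonuniqueDataAt f (q : ℚ) := by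
  rintro p ⟨T, hT, x, y, hx, hy, hx0, hy0, t, ht, hne⟩
  have ht0 : 0 < t := by
    refine ht.1.lt_of_ne fun h => hne ?_
    rw [← h, hx0, hy0]
  have hc : ContinuousOn (fun s => x s - y s) (Icc 0 T) := by
    have := hx.1.continuousOn.sub hy.1.continuousOn
    rwa [uIcc_of_le hT.le] at this
  have hev : ∀ᶠ s in 𝓝[Icc 0 T] t, x s - y s ≠ 0 := (hc t ht).eventually_ne (sub_ne_zero.2 hne)
  have hev' : ∀ᶠ s in 𝓝[<] t, x s - y s ≠ 0 := by
    rw [← nhdsWithin_Ioo_eq_nhdsLT ht0]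
    have hsub : Ioo 0 t ⊆ Icc 0 T := fun s hs => ⟨hs.1.le, hs.2.le.trans ht.2⟩
    exact nhdsWithin_mono t hsub hev
  obtain ⟨l, hl, hlt⟩ := (mem_nhdsLT_iff_exists_Ioo_subset' ht0).1 hev'
  obtain ⟨q, hq1, hq2⟩ := exists_rat_btwn (max_lt hl ht0)
  have hq0 : (0 : ℝ) < q := (le_max_right _ _).trans_lt hq1
  refine mem_iUnion.2 ⟨⟨q, by exact_mod_cast hq0⟩, x, y, hx.mono hq0.le (hq2.le.trans ht.2),
    hy.mono hq0.le (hq2.le.trans ht.2), hx0, hy0, ?_⟩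
  exact sub_ne_zero.1 (hlt ⟨(le_max_left _ _).trans_lt hq1, hq2⟩)

variable [FiniteDimensional ℝ E]

/-- If a bounded field is expansive up to a quadratic error, relative to bounded Lipschitz fields
approximating it, then the Filippov solutions of two different states at time `T` with the same
initial state lie in a nondiscrete fibre of a Lipschitz map (the backward time-`T` map). -/
theorem exists_lipschitzWith_frequently_eq_of_filippov {f : E → E} {h : ℕ → E → E}
    {K : ℕ → ℝ≥0} {M : ℝ≥0} {C : ℝ} {ε : ℕ → ℝ} (hC : 0 ≤ C) (hε : ∀ k, 0 ≤ ε k)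
    (hε0 : Tendsto ε atTop (𝓝 0)) (hf : ∀ x, ‖f x‖ ≤ M) (hM : ∀ k x, ‖h k x‖ ≤ M)
    (hK : ∀ k, LipschitzWith (K k) (h k))
    (hfh : ∀ k x y, -(C * ‖x - y‖ ^ 2) - ε k ≤ inner ℝ (f x - h k y) (x - y))
    (hhh : ∀ k m x y, -(C * ‖x - y‖ ^ 2) - (ε k + ε m) ≤ inner ℝ (h k x - h m y) (x - y))
    {T : ℝ} (hT : 0 ≤ T) :
    ∃ (g : E → E) (L : ℝ≥0), LipschitzWith L g ∧ ∀ p ∈ filippovNonuniqueDataAt f T,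
      ∃ z, g z = p ∧ ∃ᶠ z' in 𝓝[≠] z, g z' = p := by
  choose Φ S hΦ hΦS hSΦ hS using fun k => (hK k).exists_flow_of_bounded (hM k) hT
  set D := Real.exp (2 * C * T) with hD
  have hD0 : 0 < D := Real.exp_pos _
  set η : ℕ → ℝ := fun k => √(D * (2 * T * ε k)) with hη
  have hη0 : Tendsto η atTop (𝓝 0) := by
    have : Tendsto (fun k => √(D * (2 * T * ε k))) atTop (𝓝 √(D * (2 * T * 0))) :=
      ((hε0.const_mul _).const_mul _).sqrt
    simpa using this
  have hac : ∀ {k} {y : ℝ → E}, (∀ t ∈ Icc 0 T, HasDerivAt y (h k (y t)) t) →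
      AbsolutelyContinuousOnInterval y 0 T := fun hy =>
    absolutelyContinuousOnInterval_of_hasDerivAt_of_bounded (hM _) hT hy
  -- Backward Grönwall against the `h k`-trajectory that ends at the same point `x T`.
  have hsol : ∀ k {x : ℝ → E}, IsFilippovSolution f T x → ‖x 0 - S k (x T)‖ ≤ η k := by
    intro k x hx
    obtain ⟨y, hyT, hy0, hy⟩ := hS k (x T)
    refine Real.le_sqrt_of_sq_le ?_
    have := norm_sub_sq_le_of_ae_inner_deriv_ge hT hC (hε k) hx.1 (hac hy) ?_
    · rw [hyT, hy0] at this
      simpa using this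
    · filter_upwards [hx.2, ae_restrict_mem measurableSet_Icc] with t ⟨v, hv, hv'⟩ ht
      exact ⟨v, _, hv', hy t ht,
        inner_sub_ge_of_mem_filippovMap hf hC (hM k _) (fun u => hfh k u _) hv⟩
  have hSS : ∀ k m z z', ‖S k z - S m z'‖ ^ 2 ≤ D * (‖z - z'‖ ^ 2 + 2 * T * (ε k + ε m)) := by
    intro k m z z'
    obtain ⟨y, hyT, hy0, hy⟩ := hS k z
    obtain ⟨y', hyT', hy0', hy'⟩ := hS m z'
    have := norm_sub_sq_le_of_ae_inner_deriv_ge hT hC (add_nonneg (hε k) (hε m)) (hac hy) (hac hy')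
      ?_
    · rwa [hyT, hy0, hyT', hy0'] at this
    · filter_upwards [ae_restrict_mem measurableSet_Icc] with t ht
      exact ⟨_, _, hy t ht, hy' t ht, hhh k m _ _⟩
  have hlim : ∀ z, ∃ w, Tendsto (fun k => S k z) atTop (𝓝 w) := by
    refine fun z => cauchySeq_tendsto_of_complete (cauchySeq_iff_tendsto_dist_atTop_0.2 ?_)
    have h0 : Tendsto (fun n : ℕ × ℕ => √(D * (‖z - z‖ ^ 2 + 2 * T * (ε n.1 + ε n.2)))) atTop
        (𝓝 √(D * (‖z - z‖ ^ 2 + 2 * T * (0 + 0)))) := by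
      rw [← prod_atTop_atTop_eq]
      exact (((((hε0.comp tendsto_fst).add (hε0.comp tendsto_snd)).const_mul _).const_add
        _).const_mul _).sqrt
    simp only [sub_self, norm_zero, add_zero, mul_zero, Real.sqrt_zero, ne_eq, OfNat.ofNat_ne_zero,
      not_false_eq_true, zero_pow, zero_add] at h0
    refine squeeze_zero (fun _ => dist_nonneg) (fun n => ?_) h0
    rw [dist_eq_norm]
    refine Real.le_sqrt_of_sq_le ?_
    simpa using hSS n.1 n.2 z z
  choose g hg using hlim
  have hgS : ∀ k z, ‖S k z - g z‖ ≤ η k := by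
    intro k z
    refine Real.le_sqrt_of_sq_le ?_
    have h1 : Tendsto (fun m => ‖S k z - S m z‖ ^ 2) atTop (𝓝 (‖S k z - g z‖ ^ 2)) :=
      ((tendsto_const_nhds.sub (hg z)).norm).pow 2
    have h2 : Tendsto (fun m => D * (‖z - z‖ ^ 2 + 2 * T * (ε k + ε m))) atTop
        (𝓝 (D * (‖z - z‖ ^ 2 + 2 * T * (ε k + 0)))) :=
      (((hε0.const_add _).const_mul _).const_add _).const_mul _
    simpa using le_of_tendsto_of_tendsto' h1 h2 fun m => hSS k m z z
  have hLip : LipschitzWith (√D).toNNReal g := by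
    refine LipschitzWith.of_dist_le_mul fun z z' => ?_
    have h1 : Tendsto (fun k => ‖S k z - S k z'‖ ^ 2) atTop (𝓝 (‖g z - g z'‖ ^ 2)) :=
      (((hg z).sub (hg z')).norm).pow 2
    have h2 : Tendsto (fun k => D * (‖z - z'‖ ^ 2 + 2 * T * (ε k + ε k))) atTop
        (𝓝 (D * (‖z - z'‖ ^ 2 + 2 * T * (0 + 0)))) :=
      (((hε0.add hε0).const_mul _).const_add _).const_mul _
    have h3 := le_of_tendsto_of_tendsto' h1 h2 fun k => hSS k k z z'
    rw [dist_eq_norm, dist_eq_norm, Real.coe_toNNReal _ (Real.sqrt_nonneg _)]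
    refine abs_le_of_sq_le_sq' ?_ (by positivity) |>.2
    rw [mul_pow, Real.sq_sqrt hD0.le]
    simpa using h3
  refine ⟨g, _, hLip, ?_⟩
  rintro p ⟨x, y, hx, hy, rfl, hy0, hne⟩
  refine ⟨x T, ?_, ?_⟩
  · refine (tendsto_nhds_unique (hg (x T)) (tendsto_iff_norm_sub_tendsto_zero.2 ?_))
    refine squeeze_zero (fun _ => norm_nonneg _) (fun k => ?_) hη0
    rw [norm_sub_rev]
    exact hsol k hx
  have hsphere : ∀ r, 0 < r → r < ‖y T - x T‖ → ∃ z ∈ sphere (x T) r, g z = x 0 := by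
    intro r hr hr'
    -- The flow image of a small ball around `x 0` is connected and contains both `x T` and `y T`,
    -- so it meets the sphere. On this image `g` is within `2 * η k` of `x 0`.
    have hk : ∀ k, ∃ z ∈ sphere (x T) r, dist (g z) (x 0) ≤ 2 * η k := by
      intro k
      have hconn : IsPreconnected (Φ k '' closedBall (x 0) (η k)) :=
        (convex_closedBall _ _).isPreconnected.image _ (hΦ k).continuousOn
      have hxm : x T ∈ Φ k '' closedBall (x 0) (η k) :=
        ⟨S k (x T), by rw [mem_closedBall', dist_eq_norm]; exact hsol k hx, hΦS k _⟩
      have hym : y T ∈ Φ k '' closedBall (x 0) (η k) :=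
        ⟨S k (y T), by rw [mem_closedBall', dist_eq_norm, ← hy0]; exact hsol k hy, hΦS k _⟩
      obtain ⟨z, ⟨q, hq, rfl⟩, hz⟩ := hconn.intermediate_value hxm hym
        (f := fun z => ‖z - x T‖) (by fun_prop) (show r ∈ _ from ⟨by simpa using hr.le, hr'.le⟩)
      refine ⟨Φ k q, by rwa [mem_sphere, dist_eq_norm], ?_⟩
      have h1 := hgS k (Φ k q)
      rw [hSΦ, ← dist_eq_norm, dist_comm] at h1
      linarith [dist_triangle (g (Φ k q)) q (x 0), mem_closedBall.1 hq]
    -- By compactness the minimal distance is attained. It is at most `2 * η k` for every `k`, hence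
    -- zero.
    obtain ⟨z, hz, hmin⟩ := (isCompact_sphere (x T) r).exists_isMinOn
      (f := fun z => dist (g z) (x 0)) ((hk 0).imp fun _ h => h.1)
      (hLip.continuous.dist continuous_const).continuousOn
    refine ⟨z, hz, dist_le_zero.1 (ge_of_tendsto' (x := atTop) (f := fun k => 2 * η k)
      (by simpa using hη0.const_mul 2) fun k => ?_)⟩
    obtain ⟨z', hz', hle⟩ := hk k
    exact (hmin hz').trans hle
  rw [frequently_nhdsWithin_iff, Metric.nhds_basis_ball.frequently_iff]
  intro r hr
  have hpos : 0 < ‖y T - x T‖ := norm_pos_iff.2 (sub_ne_zero.2 hne.symm)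
  obtain ⟨z, hz, hgz⟩ := hsphere (min r ‖y T - x T‖ / 2) (by positivity)
    ((half_lt_self (by positivity)).trans_le (min_le_right _ _))
  rw [mem_sphere] at hz
  refine ⟨z, ?_, hgz, ?_⟩
  · rw [mem_ball, hz]
    exact (half_lt_self (by positivity)).trans_le (min_le_left _ _)
  · rintro rfl
    rw [dist_self] at hz
    have : 0 < min r ‖y T - x T‖ / 2 := by positivity
    linarith

/-- Almost everywhere uniqueness of Filippov solutions for a bounded field that is expansive up
to a quadratic error, relative to bounded Lipschitz fields approximating it. -/
theorem volume_filippovNonuniqueData_eq_zero [BorelSpace E]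
    [(volume : Measure E).IsAddHaarMeasure] {f : E → E} {h : ℕ → E → E}
    {K : ℕ → ℝ≥0} {M : ℝ≥0} {C : ℝ} {ε : ℕ → ℝ} (hC : 0 ≤ C) (hε : ∀ k, 0 ≤ ε k)
    (hε0 : Tendsto ε atTop (𝓝 0)) (hf : ∀ x, ‖f x‖ ≤ M) (hM : ∀ k x, ‖h k x‖ ≤ M)
    (hK : ∀ k, LipschitzWith (K k) (h k))
    (hfh : ∀ k x y, -(C * ‖x - y‖ ^ 2) - ε k ≤ inner ℝ (f x - h k y) (x - y))
    (hhh : ∀ k m x y, -(C * ‖x - y‖ ^ 2) - (ε k + ε m) ≤ inner ℝ (h k x - h m y) (x - y)) :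
    volume (filippovNonuniqueData f) = 0 := by
  refine measure_mono_null (filippovNonuniqueData_subset f) (measure_iUnion_null fun q => ?_)
  have hq : (0 : ℝ) ≤ (q : ℚ) := by exact_mod_cast q.2.le
  obtain ⟨g, L, hg, hfib⟩ :=
    exists_lipschitzWith_frequently_eq_of_filippov hC hε hε0 hf hM hK hfh hhh hq
  refine measure_mono_null (fun p hp => ?_) (ae_iff.1 (hg.ae_forall_eventually_ne volume))
  obtain ⟨z, hz, hfr⟩ := hfib p hp
  exact fun h => hfr (h z hz)

end Filippov

/-! ### Pairwise attraction kernels and their one-sided Lipschitz bound. -/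

section Kernel

variable {F : Type*} [NormedAddCommGroup F] [InnerProductSpace ℝ F]

/-- The attraction `χ(‖u‖) φ(‖u‖) u` with interaction strength `φ` (frozen beyond `1`) and
cutoff `χ`. -/
def cutoffKernel (χ φ : ℝ → ℝ) (u : F) : F :=
  (χ ‖u‖ * φ (min ‖u‖ 1)) • u

/-- `χ` is a cutoff with values in `[0, 1]`, equal to `1` on `[0, 1)` and to `0` on `[θ, ∞)`. -/
structure IsCutoff (χ : ℝ → ℝ) (θ : ℝ) : Prop where
  nonneg : ∀ r, 0 ≤ χ r
  le_one : ∀ r, χ r ≤ 1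
  eq_one : ∀ r, r < 1 → χ r = 1
  eq_zero : ∀ r, θ ≤ r → χ r = 0
  one_le : 1 ≤ θ
  le_two : θ ≤ 2

/-- `φ` takes values in `[0, B]` on `[0, 1]` and is `K`-Lipschitz there. -/
structure IsInteraction (φ : ℝ → ℝ) (B K : ℝ) : Prop where
  nonneg : ∀ r ∈ Icc (0 : ℝ) 1, 0 ≤ φ r
  le : ∀ r ∈ Icc (0 : ℝ) 1, φ r ≤ B
  lip : ∀ r ∈ Icc (0 : ℝ) 1, ∀ s ∈ Icc (0 : ℝ) 1, |φ r - φ s| ≤ K * |r - s|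

theorem norm_min_one_mem {F : Type*} [NormedAddCommGroup F] (u : F) : min ‖u‖ 1 ∈ Icc (0 : ℝ) 1 :=
  ⟨le_min (norm_nonneg _) zero_le_one, min_le_right _ _⟩

theorem cutoffKernel_neg (χ φ : ℝ → ℝ) (u : F) : cutoffKernel χ φ (-u) = -cutoffKernel χ φ u := by
  simp [cutoffKernel]

variable {χ χ' φ : ℝ → ℝ} {θ θ' B K : ℝ}

/-- The change of strength multiplies the shorter vector `v`: either `‖v‖ ≤ 1`, or both strengths
are frozen at `φ 1` and do not change. -/
theorem IsInteraction.norm_smul_sub_smul_le (hφ : IsInteraction φ B K) (hK : 0 ≤ K) (u v : F) :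
    ‖φ (min ‖u‖ 1) • u - φ (min ‖v‖ 1) • v‖ ≤ (B + K) * ‖u - v‖ := by
  wlog huv : ‖v‖ ≤ ‖u‖ generalizing u v
  · rw [norm_sub_rev, norm_sub_rev u v]
    exact this v u (le_of_not_ge huv)
  have h1 : φ (min ‖u‖ 1) • u - φ (min ‖v‖ 1) • v =
      φ (min ‖u‖ 1) • (u - v) + (φ (min ‖u‖ 1) - φ (min ‖v‖ 1)) • v := by module
  have h2 : ‖φ (min ‖u‖ 1) • (u - v)‖ ≤ B * ‖u - v‖ := by
    rw [norm_smul, Real.norm_eq_abs, abs_of_nonneg (hφ.nonneg _ (norm_min_one_mem u))]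
    exact mul_le_mul_of_nonneg_right (hφ.le _ (norm_min_one_mem u)) (norm_nonneg _)
  have h3 : ‖(φ (min ‖u‖ 1) - φ (min ‖v‖ 1)) • v‖ ≤ K * ‖u - v‖ := by
    rw [norm_smul, Real.norm_eq_abs]
    rcases le_total ‖v‖ 1 with hv | hv
    · have h4 := hφ.lip _ (norm_min_one_mem u) _ (norm_min_one_mem v)
      have h5 : |min ‖u‖ 1 - min ‖v‖ 1| ≤ ‖u - v‖ :=
        (abs_min_sub_min_le_max _ _ _ _).trans (by simpa using abs_norm_sub_norm_le u v)
      calc _ ≤ (K * |min ‖u‖ 1 - min ‖v‖ 1|) * 1 :=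
            mul_le_mul h4 hv (norm_nonneg _) (by positivity)
        _ ≤ _ := by rw [mul_one]; exact mul_le_mul_of_nonneg_left h5 hK
    · rw [min_eq_right hv, min_eq_right (hv.trans huv), sub_self, abs_zero, zero_mul]
      positivity
  rw [h1, add_mul]
  exact (norm_add_le _ _).trans (add_le_add h2 h3)

theorem IsCutoff.norm_smul_le (hχ : IsCutoff χ θ) (hφ : IsInteraction φ B K) (u : F) :
    ‖cutoffKernel χ φ u‖ ≤ B * 2 := by
  have h0 := hφ.nonneg _ (norm_min_one_mem u)
  have hB := hφ.le _ (norm_min_one_mem u)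
  have hB0 : 0 ≤ B := h0.trans hB
  rcases le_total θ ‖u‖ with hu | hu
  · rw [cutoffKernel, hχ.eq_zero _ hu, zero_mul, zero_smul, norm_zero]
    positivity
  · rw [cutoffKernel, norm_smul, Real.norm_eq_abs, abs_of_nonneg (mul_nonneg (hχ.nonneg _) h0)]
    refine mul_le_mul ?_ (hu.trans hχ.le_two) (norm_nonneg _) hB0
    simpa using mul_le_mul (hχ.le_one ‖u‖) hB h0 zero_le_one

/-- The constant blows up with the slope `L` of the ramp. This is harmless, since it only serves to
produce flows and never enters the limiting estimates. -/
theorem IsCutoff.norm_cutoffKernel_sub_le (hχ : IsCutoff χ θ) (hφ : IsInteraction φ B K)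
    (hK : 0 ≤ K) {L : ℝ} (hL : 0 ≤ L) (hLip : ∀ r s, |χ r - χ s| ≤ L * |r - s|) (u v : F) :
    ‖cutoffKernel χ φ u - cutoffKernel χ φ v‖ ≤ (B + K + L * (B * 2)) * ‖u - v‖ := by
  wlog huv : ‖v‖ ≤ ‖u‖ generalizing u v
  · rw [norm_sub_rev, norm_sub_rev u v]
    exact this v u (le_of_not_ge huv)
  have h0 := hφ.nonneg _ (norm_min_one_mem v)
  have hB := hφ.le _ (norm_min_one_mem v)
  have hB0 : 0 ≤ B := h0.trans hB
  rcases le_total θ ‖v‖ with hv | hv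
  · rw [cutoffKernel, cutoffKernel, hχ.eq_zero _ hv, hχ.eq_zero _ (hv.trans huv)]
    simp only [zero_mul, zero_smul, sub_zero, norm_zero]
    positivity
  · have h1 : cutoffKernel χ φ u - cutoffKernel χ φ v =
        χ ‖u‖ • (φ (min ‖u‖ 1) • u - φ (min ‖v‖ 1) • v) +
          (χ ‖u‖ - χ ‖v‖) • (φ (min ‖v‖ 1) • v) := by
      simp only [cutoffKernel]
      module
    have h2 : ‖χ ‖u‖ • (φ (min ‖u‖ 1) • u - φ (min ‖v‖ 1) • v)‖ ≤ (B + K) * ‖u - v‖ := by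
      rw [norm_smul, Real.norm_eq_abs, abs_of_nonneg (hχ.nonneg _)]
      exact (mul_le_of_le_one_left (norm_nonneg _) (hχ.le_one _)).trans
        (hφ.norm_smul_sub_smul_le hK u v)
    have h3 : ‖(χ ‖u‖ - χ ‖v‖) • (φ (min ‖v‖ 1) • v)‖ ≤ L * ‖u - v‖ * (B * 2) := by
      rw [norm_smul, norm_smul, Real.norm_eq_abs, Real.norm_eq_abs (φ _), abs_of_nonneg h0]
      refine mul_le_mul ((hLip _ _).trans (mul_le_mul_of_nonneg_left
        (abs_norm_sub_norm_le u v) hL)) ?_ (by positivity) (by positivity)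
      exact mul_le_mul hB (hv.trans hχ.le_two) (norm_nonneg _) hB0
    rw [h1]
    refine (norm_add_le _ _).trans ((add_le_add h2 h3).trans_eq ?_)
    ring

/-- The attraction kernels are one-sided Lipschitz, up to the widths of the cutoffs: switching the
attraction off at distance `1` only helps in this direction. -/
theorem IsCutoff.inner_cutoffKernel_sub_le (hχ : IsCutoff χ θ) (hχ' : IsCutoff χ' θ')
    (hφ : IsInteraction φ B K) (hK : 0 ≤ K) (u v : F) :
    inner ℝ (cutoffKernel χ φ u - cutoffKernel χ' φ v) (u - v) ≤
      (2 * B + K) * ‖u - v‖ ^ 2 + B * ((θ ^ 2 - 1) + (θ' ^ 2 - 1)) := by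
  have h0 := hφ.nonneg _ (norm_min_one_mem v)
  have hB := hφ.le _ (norm_min_one_mem v)
  have hB0 : 0 ≤ B := h0.trans hB
  set p := χ ‖u‖
  set q := χ' ‖v‖
  set b := φ (min ‖v‖ 1)
  have hp0 : 0 ≤ p := hχ.nonneg _
  have hp1 : p ≤ 1 := hχ.le_one _
  have hq0 : 0 ≤ q := hχ'.nonneg _
  have hq1 : q ≤ 1 := hχ'.le_one _
  have hθ : 0 ≤ θ ^ 2 - 1 := by nlinarith [hχ.one_le]
  have hθ' : 0 ≤ θ' ^ 2 - 1 := by nlinarith [hχ'.one_le]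
  have h1 : inner ℝ (cutoffKernel χ φ u - cutoffKernel χ' φ v) (u - v) =
      p * inner ℝ (φ (min ‖u‖ 1) • u - b • v) (u - v) + (p - q) * b * inner ℝ v (u - v) := by
    rw [← real_inner_smul_left, ← real_inner_smul_left, ← inner_add_left]
    congr 1
    simp only [cutoffKernel]
    module
  have h2 : p * inner ℝ (φ (min ‖u‖ 1) • u - b • v) (u - v) ≤ (B + K) * ‖u - v‖ ^ 2 := by
    have h3 : inner ℝ (φ (min ‖u‖ 1) • u - b • v) (u - v) ≤ (B + K) * ‖u - v‖ ^ 2 := by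
      refine (real_inner_le_norm _ _).trans ?_
      rw [sq, ← mul_assoc]
      exact mul_le_mul_of_nonneg_right (hφ.norm_smul_sub_smul_le hK u v) (norm_nonneg _)
    exact (mul_le_mul_of_nonneg_left h3 hp0).trans (mul_le_of_le_one_left (by positivity) hp1)
  have h4 : ‖u‖ ^ 2 = ‖v‖ ^ 2 + 2 * inner ℝ v (u - v) + ‖u - v‖ ^ 2 := by
    rw [← norm_add_sq_real, add_sub_cancel]
  have hd : 0 ≤ ‖u - v‖ ^ 2 := by positivity
  -- Use `2⟪v, u - v⟫ = ‖u‖ ^ 2 - ‖v‖ ^ 2 - ‖u - v‖ ^ 2`. The vector with the smaller cutoff value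
  -- has norm at least 1, and the other lies within its cutoff radius, so the sign is favourable up
  -- to the ramp widths.
  have h5 : (p - q) * b * inner ℝ v (u - v) ≤
      B * (‖u - v‖ ^ 2 + ((θ ^ 2 - 1) + (θ' ^ 2 - 1))) := by
    rcases lt_trichotomy p q with hpq | hpq | hpq
    · have hu : 1 ≤ ‖u‖ := by
        by_contra! h
        linarith [hχ.eq_one _ h]
      have hv : ‖v‖ ≤ θ' := by
        by_contra! h
        linarith [hχ'.eq_zero _ h.le]
      have hu2 : 1 ≤ ‖u‖ ^ 2 := one_le_pow₀ hu
      have hv2 : ‖v‖ ^ 2 ≤ θ' ^ 2 := pow_le_pow_left₀ (norm_nonneg _) hv 2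
      calc (p - q) * b * inner ℝ v (u - v) = ((q - p) * b) * -inner ℝ v (u - v) := by ring
        _ ≤ ((q - p) * b) * (‖u - v‖ ^ 2 + ((θ ^ 2 - 1) + (θ' ^ 2 - 1))) :=
          mul_le_mul_of_nonneg_left (by linarith) (mul_nonneg (by linarith) h0)
        _ ≤ _ := mul_le_mul_of_nonneg_right
          ((mul_le_of_le_one_left h0 (by linarith)).trans hB) (by positivity)
    · rw [hpq, sub_self, zero_mul, zero_mul]
      positivity
    · have hv : 1 ≤ ‖v‖ := by
        by_contra! h
        linarith [hχ'.eq_one _ h]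
      have hu : ‖u‖ ≤ θ := by
        by_contra! h
        linarith [hχ.eq_zero _ h.le]
      have hv2 : 1 ≤ ‖v‖ ^ 2 := one_le_pow₀ hv
      have hu2 : ‖u‖ ^ 2 ≤ θ ^ 2 := pow_le_pow_left₀ (norm_nonneg _) hu 2
      calc (p - q) * b * inner ℝ v (u - v)
          ≤ ((p - q) * b) * (‖u - v‖ ^ 2 + ((θ ^ 2 - 1) + (θ' ^ 2 - 1))) :=
          mul_le_mul_of_nonneg_left (by linarith) (mul_nonneg (by linarith) h0)
        _ ≤ _ := mul_le_mul_of_nonneg_right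
          ((mul_le_of_le_one_left h0 (by linarith)).trans hB) (by positivity)
  rw [h1]
  linarith

/-- The sharp cutoff at `1`. -/
theorem isCutoff_indicator : IsCutoff (indicator (Iio 1) 1) 1 where
  nonneg r := indicator_nonneg (fun _ _ => zero_le_one) r
  le_one r := indicator_le_self' (fun _ _ => zero_le_one) r
  eq_one _ hr := indicator_of_mem (mem_Iio.2 hr) _
  eq_zero _ hr := indicator_of_notMem (notMem_Iio.2 hr) _
  one_le := le_rfl
  le_two := one_le_two

/-- The piecewise linear cutoff descending from `1` at `1` to `0` at `1 + 1 / (k + 1)`. -/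
def rampCutoff (k : ℕ) (r : ℝ) : ℝ :=
  max 0 (min 1 (1 - (k + 1) * (r - 1)))

theorem isCutoff_rampCutoff (k : ℕ) : IsCutoff (rampCutoff k) (1 + 1 / (k + 1)) where
  nonneg r := le_max_left _ _
  le_one r := max_le zero_le_one (min_le_left _ _)
  eq_one r hr := by
    have : 1 ≤ 1 - ((k : ℝ) + 1) * (r - 1) := by
      nlinarith [mul_nonneg (by positivity : (0 : ℝ) ≤ k + 1) (sub_nonneg.2 hr.le)]
    rw [rampCutoff, min_eq_left this, max_eq_right zero_le_one]
  eq_zero r hr := by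
    have : 1 - ((k : ℝ) + 1) * (r - 1) ≤ 0 := by
      have h1 : (1 : ℝ) / (k + 1) ≤ r - 1 := by linarith
      rw [div_le_iff₀ (by positivity)] at h1
      linarith
    exact max_eq_left ((min_le_right _ _).trans this)
  one_le := by
    have : (0 : ℝ) ≤ 1 / (k + 1) := by positivity
    linarith
  le_two := by
    have : (1 : ℝ) / (k + 1) ≤ 1 := by
      rw [div_le_one (by positivity)]
      simp
    linarith

theorem abs_rampCutoff_sub_le (k : ℕ) (r s : ℝ) :
    |rampCutoff k r - rampCutoff k s| ≤ (k + 1) * |r - s| := by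
  refine (abs_max_sub_max_le_max _ _ _ _).trans (max_le (by simp; positivity) ?_)
  refine (abs_min_sub_min_le_max _ _ _ _).trans (max_le (by simp; positivity) ?_)
  rw [show 1 - ((k : ℝ) + 1) * (r - 1) - (1 - (k + 1) * (s - 1)) = (k + 1) * (s - r) by ring,
    abs_mul, abs_of_nonneg (by positivity : (0 : ℝ) ≤ k + 1), abs_sub_comm]

end Kernel

/-! ### The Hegselmann–Krause fields. -/

section HK

variable {n N : ℕ}

theorem HKState.norm_le_of_forall_norm_le {x : HKState n N} {c : ℝ} (hc : 0 ≤ c)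
    (h : ∀ i, ‖x i‖ ≤ c) : ‖x‖ ≤ N * c := by
  refine abs_le_of_sq_le_sq' ?_ (by positivity) |>.2
  rw [PiLp.norm_sq_eq_of_L2]
  calc ∑ i, ‖x i‖ ^ 2 ≤ ∑ _i : Fin N, c ^ 2 :=
        Finset.sum_le_sum fun i _ => pow_le_pow_left₀ (norm_nonneg _) (h i) 2
    _ = N * c ^ 2 := by simp
    _ ≤ (N * N) * c ^ 2 := by
        refine mul_le_mul_of_nonneg_right ?_ (by positivity)
        exact_mod_cast Nat.le_mul_self N
    _ = (N * c) ^ 2 := by ring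

/-- The Hegselmann-Krause field with cutoff `χ`. -/
noncomputable def hkCutoffField (χ : ℝ → ℝ) (φ : Fin N → Fin N → ℝ → ℝ) (x : HKState n N) : HKState n N :=
  WithLp.toLp 2 fun i => ∑ j, cutoffKernel χ (φ i j) (x j - x i)

/-- This places the discontinuous field in the same family as its approximations, with `θ = 1` and
hence zero error. -/
theorem hkField_eq_hkCutoffField (φ : Fin N → Fin N → ℝ → ℝ) :
    (hkField φ : HKState n N → HKState n N) = hkCutoffField (indicator (Iio 1) 1) φ := by
  funext x
  simp only [hkField, hkCutoffField, cutoffKernel]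
  congr 1
  funext i
  refine Finset.sum_congr rfl fun j _ => ?_
  rw [norm_sub_rev (x j) (x i)]
  congr 1
  rcases lt_or_ge ‖x i - x j‖ 1 with h | h
  · rw [hkCutoff, indicator_of_mem (mem_Ico.2 ⟨norm_nonneg _, h⟩), indicator_of_mem (mem_Iio.2 h),
      min_eq_left h.le, Pi.one_apply, one_mul]
  · rw [hkCutoff, indicator_of_notMem (fun h' => (not_lt.2 h) (mem_Ico.1 h').2),
      indicator_of_notMem (notMem_Iio.2 h), zero_mul]

variable {φ : Fin N → Fin N → ℝ → ℝ} {χ χ' : ℝ → ℝ} {θ θ' B K : ℝ}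

theorem norm_hkCutoffField_le (hφ : ∀ i j, IsInteraction (φ i j) B K) (hB : 0 ≤ B)
    (hχ : IsCutoff χ θ) (x : HKState n N) : ‖hkCutoffField χ φ x‖ ≤ N * (N * (B * 2)) := by
  refine HKState.norm_le_of_forall_norm_le (by positivity) fun i => ?_
  refine (norm_sum_le _ _).trans ((Finset.sum_le_sum fun j _ =>
    hχ.norm_smul_le (hφ i j) (x j - x i)).trans_eq ?_)
  simp

theorem norm_hkCutoffField_sub_le (hφ : ∀ i j, IsInteraction (φ i j) B K) (hB : 0 ≤ B)
    (hK : 0 ≤ K) (hχ : IsCutoff χ θ) {L : ℝ} (hL : 0 ≤ L)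
    (hLip : ∀ r s, |χ r - χ s| ≤ L * |r - s|) (x y : HKState n N) :
    ‖hkCutoffField χ φ x - hkCutoffField χ φ y‖ ≤
      N * (N * ((B + K + L * (B * 2)) * 2)) * ‖x - y‖ := by
  rw [mul_assoc]
  have hnorm : ∀ i j, ‖(x j - x i) - (y j - y i)‖ ≤ 2 * ‖x - y‖ := fun i j => by
    have h1 : ‖x i - y i‖ ≤ ‖x - y‖ := PiLp.norm_apply_le (x - y) i
    have h2 : ‖x j - y j‖ ≤ ‖x - y‖ := PiLp.norm_apply_le (x - y) j
    rw [sub_sub_sub_comm]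
    linarith [norm_sub_le (x j - y j) (x i - y i)]
  refine HKState.norm_le_of_forall_norm_le (by positivity) fun i => ?_
  have h1 : (hkCutoffField χ φ x - hkCutoffField χ φ y) i =
      ∑ j, (cutoffKernel χ (φ i j) (x j - x i) - cutoffKernel χ (φ i j) (y j - y i)) := by
    simp [hkCutoffField, Finset.sum_sub_distrib]
  rw [h1]
  have h2 : ∀ j, ‖cutoffKernel χ (φ i j) (x j - x i) - cutoffKernel χ (φ i j) (y j - y i)‖ ≤
      (B + K + L * (B * 2)) * (2 * ‖x - y‖) := fun j =>
    (hχ.norm_cutoffKernel_sub_le (hφ i j) hK hL hLip _ _).trans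
      (mul_le_mul_of_nonneg_left (hnorm i j) (by positivity))
  refine (norm_sum_le _ _).trans ((Finset.sum_le_sum fun j _ => h2 j).trans_eq ?_)
  simp only [Finset.sum_const, Finset.card_univ, Fintype.card_fin, nsmul_eq_mul]
  ring

/-- By symmetry of the interactions, Hegselmann-Krause fields are expansive up to a quadratic
error and the widths of the cutoffs. -/
theorem inner_hkCutoffField_sub_ge (hφ : ∀ i j, IsInteraction (φ i j) B K) (hB : 0 ≤ B)
    (hK : 0 ≤ K) (hsymm : ∀ i j, ∀ r ∈ Icc (0 : ℝ) 1, φ i j r = φ j i r)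
    (hχ : IsCutoff χ θ) (hχ' : IsCutoff χ' θ') (x y : HKState n N) :
    -(N ^ 2 * (2 * (2 * B + K)) * ‖x - y‖ ^ 2) -
        (N ^ 2 * B * (θ ^ 2 - 1) + N ^ 2 * B * (θ' ^ 2 - 1)) ≤
      inner ℝ (hkCutoffField χ φ x - hkCutoffField χ' φ y) (x - y) := by
  set A : Fin N → Fin N → EuclideanSpace ℝ (Fin n) := fun i j =>
    cutoffKernel χ (φ i j) (x j - x i) - cutoffKernel χ' (φ i j) (y j - y i) with hA
  have hanti : ∀ i j, A j i = -A i j := fun i j => by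
    have : ∀ (c : ℝ → ℝ) (u : EuclideanSpace ℝ (Fin n)),
        cutoffKernel c (φ j i) (-u) = -cutoffKernel c (φ i j) u := fun c u => by
      rw [cutoffKernel_neg, cutoffKernel, cutoffKernel, hsymm j i _ (norm_min_one_mem u)]
    simp only [hA]
    rw [← neg_sub (x j) (x i), ← neg_sub (y j) (y i), this, this]
    abel
  have hterm : ∀ i j, inner ℝ (A i j) ((x j - y j) - (x i - y i)) ≤
      (2 * B + K) * (4 * ‖x - y‖ ^ 2) + B * ((θ ^ 2 - 1) + (θ' ^ 2 - 1)) := fun i j => by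
    have h1 : ‖x i - y i‖ ≤ ‖x - y‖ := PiLp.norm_apply_le (x - y) i
    have h2 : ‖x j - y j‖ ≤ ‖x - y‖ := PiLp.norm_apply_le (x - y) j
    have h3 : ‖(x j - x i) - (y j - y i)‖ ^ 2 ≤ 4 * ‖x - y‖ ^ 2 := by
      have h4 : ‖(x j - x i) - (y j - y i)‖ ≤ 2 * ‖x - y‖ := by
        rw [sub_sub_sub_comm]
        linarith [norm_sub_le (x j - y j) (x i - y i)]
      calc _ ≤ (2 * ‖x - y‖) ^ 2 := pow_le_pow_left₀ (norm_nonneg _) h4 2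
        _ = _ := by ring
    rw [sub_sub_sub_comm]
    refine (hχ.inner_cutoffKernel_sub_le hχ' (hφ i j) hK _ _).trans ?_
    gcongr
  have hinner : inner ℝ (hkCutoffField χ φ x - hkCutoffField χ' φ y) (x - y) =
      ∑ i, ∑ j, inner ℝ (A i j) (x i - y i) := by
    rw [PiLp.inner_apply]
    refine Finset.sum_congr rfl fun i _ => ?_
    rw [← sum_inner]
    congr 1
    simp [hkCutoffField, hA, Finset.sum_sub_distrib]
  -- Antisymmetry of `A` makes the inner product `-1/2` times the sum bounded in `hsum`, so the
  -- upper bound on kernels becomes a lower bound.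
  have hswap : ∑ i, ∑ j, inner ℝ (A i j) (x i - y i) =
      -∑ i, ∑ j, inner ℝ (A i j) (x j - y j) := by
    rw [Finset.sum_comm, ← Finset.sum_neg_distrib]
    refine Finset.sum_congr rfl fun i _ => ?_
    rw [← Finset.sum_neg_distrib]
    refine Finset.sum_congr rfl fun j _ => ?_
    rw [hanti, inner_neg_left]
  have hsum : ∑ i, ∑ j, inner ℝ (A i j) ((x j - y j) - (x i - y i)) ≤
      N * (N * ((2 * B + K) * (4 * ‖x - y‖ ^ 2) + B * ((θ ^ 2 - 1) + (θ' ^ 2 - 1)))) := by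
    refine (Finset.sum_le_sum fun i _ => Finset.sum_le_sum fun j _ => hterm i j).trans_eq ?_
    simp only [Finset.sum_const, Finset.card_univ, Fintype.card_fin, nsmul_eq_mul]
  simp only [inner_sub_right, Finset.sum_sub_distrib] at hsum hswap hinner
  have hθ : 0 ≤ θ ^ 2 - 1 := by nlinarith [hχ.one_le]
  have hθ' : 0 ≤ θ' ^ 2 - 1 := by nlinarith [hχ'.one_le]
  -- The factor `1/2` is kept in the quadratic term but given away in the error term.
  have hpos : 0 ≤ N * (N * (B * ((θ ^ 2 - 1) + (θ' ^ 2 - 1)))) := by positivity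
  rw [inner_sub_right]
  linarith

end HK

/-! ### Uniform constants and conclusion. -/

theorem exists_isInteraction {N : ℕ} (φ : Fin N → Fin N → ℝ → ℝ)
    (hφ_nonneg : ∀ i j, ∀ r ∈ Set.Icc (0 : ℝ) 1, 0 ≤ φ i j r)
    (hφ_lip : ∀ i j, ∃ K : NNReal, LipschitzOnWith K (φ i j) (Set.Icc (0 : ℝ) 1)) :
    ∃ B K : ℝ, 0 ≤ B ∧ 0 ≤ K ∧ ∀ i j, IsInteraction (φ i j) B K := by
  choose κ hκ using hφ_lip
  obtain ⟨K, hK⟩ := Finite.exists_le fun p : Fin N × Fin N => κ p.1 p.2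
  obtain ⟨b, hb⟩ := Finite.exists_le fun p : Fin N × Fin N => φ p.1 p.2 0
  have hlip : ∀ i j, ∀ r ∈ Icc (0 : ℝ) 1, ∀ s ∈ Icc (0 : ℝ) 1,
      |φ i j r - φ i j s| ≤ K * |r - s| := fun i j r hr s hs =>
    ((hκ i j).dist_le_mul r hr s hs).trans
      (mul_le_mul_of_nonneg_right (NNReal.coe_le_coe.2 (hK (i, j))) dist_nonneg)
  -- On `[0, 1]`, `φ r ≤ φ 0 + K`. The maximum keeps the bound nonnegative even when `N = 0`, where
  -- `b` is arbitrary.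
  refine ⟨max b 0 + K, K, by positivity, K.2, fun i j => ⟨hφ_nonneg i j, fun r hr => ?_, hlip i j⟩⟩
  have h1 := (le_abs_self _).trans (hlip i j r hr 0 (left_mem_Icc.2 zero_le_one))
  rw [sub_zero, abs_of_nonneg hr.1] at h1
  linarith [mul_le_of_le_one_right K.coe_nonneg hr.2, hb (i, j), le_max_left b 0]

theorem mainTheorem4 (n N : ℕ) (φ : Fin N → Fin N → ℝ → ℝ)
    (hφ_nonneg : ∀ i j, ∀ r ∈ Set.Icc (0 : ℝ) 1, 0 ≤ φ i j r)
    (hφ_lip : ∀ i j, ∃ K : NNReal, LipschitzOnWith K (φ i j) (Set.Icc (0 : ℝ) 1))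
    (hφ_symm : ∀ i j, ∀ r ∈ Set.Icc (0 : ℝ) 1, φ i j r = φ j i r) :
    MeasureTheory.volume
      (filippovNonuniqueData (hkField φ : HKState n N → HKState n N)) = 0 := by
  obtain ⟨B, K, hB, hK, hφ⟩ := exists_isInteraction φ hφ_nonneg hφ_lip
  set θ : ℕ → ℝ := fun k => 1 + 1 / (k + 1) with hθ
  have hθ1 : Filter.Tendsto θ Filter.atTop (𝓝 1) := by
    simpa only [add_zero] using (tendsto_one_div_add_atTop_nhds_zero_nat (𝕜 := ℝ)).const_add 1
  have hM : ∀ {χ : ℝ → ℝ} {η : ℝ}, IsCutoff χ η → ∀ x : HKState n N,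
      ‖hkCutoffField χ φ x‖ ≤ (N * (N * (B * 2))).toNNReal := fun hχ x => by
    rw [Real.coe_toNNReal _ (by positivity)]
    exact norm_hkCutoffField_le hφ hB hχ x
  rw [hkField_eq_hkCutoffField]
  refine volume_filippovNonuniqueData_eq_zero (h := fun k => hkCutoffField (rampCutoff k) φ)
    (K := fun k => (N * (N * ((B + K + (k + 1) * (B * 2)) * 2))).toNNReal)
    (C := N ^ 2 * (2 * (2 * B + K))) (ε := fun k => N ^ 2 * B * (θ k ^ 2 - 1))
    (by positivity) (fun k => ?_) ?_ (hM isCutoff_indicator)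
    (fun k => hM (isCutoff_rampCutoff k)) (fun k => ?_) (fun k x y => ?_) fun k m =>
      inner_hkCutoffField_sub_ge hφ hB hK hφ_symm (isCutoff_rampCutoff k) (isCutoff_rampCutoff m)
  · have := (isCutoff_rampCutoff k).one_le
    exact mul_nonneg (by positivity) (sub_nonneg.2 (one_le_pow₀ this))
  · simpa using ((hθ1.pow 2).sub_const 1).const_mul (N ^ 2 * B)
  · refine LipschitzWith.of_dist_le_mul fun x y => ?_
    rw [Real.coe_toNNReal _ (by positivity), dist_eq_norm, dist_eq_norm]
    exact norm_hkCutoffField_sub_le hφ hB hK (isCutoff_rampCutoff k) (by positivity)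
      (abs_rampCutoff_sub_le k) x y
  · have := inner_hkCutoffField_sub_ge hφ hB hK hφ_symm isCutoff_indicator
      (isCutoff_rampCutoff k) x y
    rwa [one_pow, sub_self, mul_zero, zero_add] at this
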